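/- Let $A=(a_{ij})\in\mathbb{R}^{N\times N}$ be row-stochastic with $a_{ii}>0$ for all $i$, and suppose that the directed graph with an edge from $j$ to $i$ whenever $a_{ij}>0$ is strongly connected. Let $\mathbf u$ be the left eigenvector of $A$ for the eigenvalue $1$ with $\sum_i u_i=1$. Let each $f_i:\mathbb{R}^n\to\mathbb{R}$ be differentiable with $l_i$-Lipschitz gradient and strongly convex with constant $\sigma_i>0$, let $x^*$ be the minimiser of $F=\frac1N\sum_i f_i$, and assume $$\frac{(\sum_i l_i)^2}{N\sum_i l_i^2}>\frac34 .$$ Time is discrete, $H=T_g/2\ge 1$ is an integer, and at time $t$ all information received from agents $j$ is delayed by $\tau(t)\in\{0,1,\dots,\tau_{\max}\}$, where $\tau_{\max}\le H$ and $\tau$ is otherwise arbitrary. Let $0<\kappa<1$. Write $x_i(k)\in\mathbb R^n$, $e_i(k)\in\mathbb{R}^N$ for the variables of agent $i$ stored from time $kH$ until time $(k+1)H$; they are constant for times $\le 0$. Here $x_i(0)$ is arbitrary and $e_i(0)$ is the $i$-th basis vector. Let $b_i(k)=\nabla f_i(x_i(k))/[e_i(k)]_i$, and let $g$ be the square wave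 with values $1,0$ and half period $H$, starting at $1$, with edges between the times $mH$ and $mH+1$, $m\ge1$. The algorithm consists of the trackers $$r_i(t+1)-r_i(t)=\sum_{m\ge 1}\mathbf 1_{\{t=mH\}}\,\bigl(b_i(m)-b_i(m-1)\bigr)-\kappa\sum_j a_{ij}\bigl(r_i(t)-r_j(t-\tau(t))\bigr),\qquad r_i(0)=b_i(0),$$ $$s_i(t+1)-s_i(t)=g(t+1)-g(t)-\kappa\sum_j a_{ij}\bigl(s_i(t)-s_j(t-\tau(t))\bigr),\qquad s_i(0)=1,$$ with $r_i(t)=0$ and $s_i(t)=0$ for $t<0$, and, for $k\ge 0$, of the updates $$e_i(k+1)=\sum_j a_{ij}e_j^{\mathrm{rec}},\qquad x_i(k+1)=\sum_j a_{ij}x_j^{\mathrm{rec}}-\alpha_k\,p_i(k+1),$$ $$p_i(k+1)=\sum_{m=1}^{k}\frac{c^r_i(m)-c^r_i(m-1)}{|c^s_i(m)-c^s_i(m-1)|}+\sum_j u_j\,b_j(0).$$ Here $e_j^{\mathrm{rec}}$, $x_j^{\mathrm{rec}}$ are the values stored at time $(k+1)H-\tau((k+1)H)$, before the update at time $(k+1)H$,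 and $c^r_i(m)$, $c^s_i(m)$ are the equilibrium states of the trackers after the $m$-th change of their inputs, that is, the limits as $t\to\infty$ of $r_i(t)$ and $s_i(t)$ when all inputs after time $mH$ are switched off. The step size is the minimiser $\alpha_k=-B_k/(2A_k)$ of $A_k\alpha^2+B_k\alpha+4$, where $$A_k=4\sum_{i=1}^N N l_i^2\Bigl(\frac{u_i}{[e_i(k)]_i}\Bigr)^2,\qquad B_k=-8\sum_{i=1}^N\frac{u_i l_i}{[e_i(k)]_i}.$$ Then the algorithm is well defined: $[e_i(k)]_i>0$, the equilibrium states exist, and $c^s_i(m)\ne c^s_i(m-1)$ for $m\ge1$. Moreover there is a constant $C>0$ such that for every $\varepsilon>0$ and every agent $i$ there is $k_3$ with $$\|x_i(k)-x^*\|<C\varepsilon\qquad\text{for all }k\ge k_3 .$$ -/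

import Mathlib

open Filter Topology

noncomputable section

namespace DelayFrost

/-- Row-stochastic weights. `A i j` is the weight with which agent `i` uses the information of
agent `j`; there is an edge from `j` to `i` exactly when `A i j > 0`. -/
def IsRowStochastic {N : ℕ} (A : Matrix (Fin N) (Fin N) ℝ) : Prop :=
  (∀ i j, 0 ≤ A i j) ∧ ∀ i, ∑ j, A i j = 1

/-- The directed graph of the weights has a directed path from every node to every node. -/
def IsStronglyConnected {N : ℕ} (A : Matrix (Fin N) (Fin N) ℝ) : Prop :=
  ∀ i j, Relation.ReflTransGen (fun a b => 0 < A b a) i j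

/-- `u` is the left eigenvector of `A` for the eigenvalue `1`, with entries summing to `1`. -/
def IsFirstLeftEigenvector {N : ℕ} (A : Matrix (Fin N) (Fin N) ℝ) (u : Fin N → ℝ) : Prop :=
  Matrix.vecMul u A = u ∧ ∑ i, u i = 1

/-- The function `f` is differentiable and its gradient is Lipschitz with constant `l`. -/
def IsSmoothWith {n : ℕ} (l : NNReal) (f : EuclideanSpace ℝ (Fin n) → ℝ) : Prop :=
  Differentiable ℝ f ∧ LipschitzWith l (gradient f)

/-- The global objective `F = (1/N) ∑ f_i`. -/
def objective {N n : ℕ} (f : Fin N → EuclideanSpace ℝ (Fin n) → ℝ)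
    (x : EuclideanSpace ℝ (Fin n)) : ℝ :=
  (1 / (N : ℝ)) * ∑ i, f i x

/-- The common square wave with values `1` and `0` and half period `H`, starting at `1`. Its
falling and rising edges are the time steps from `m * H` to `m * H + 1` with `m ≥ 1`. -/
def squareWave (H : ℕ) (t : ℕ) : ℝ :=
  if t = 0 then 1 else if Even ((t - 1) / H) then 1 else 0

/-- The delayed average tracker
`r_i(t+1) - r_i(t) = v_i(t) - κ ∑_j a_ij (r_i(t) - r_j(t - τ(t)))`,
with input increments `v`, `r(0) = r0` and `r(t) = 0` for `t < 0`. -/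
def tracker {N : ℕ} {V : Type*} [AddCommGroup V] [Module ℝ V]
    (A : Matrix (Fin N) (Fin N) ℝ) (κ : ℝ) (τ : ℕ → ℕ) (v : ℕ → Fin N → V) (r0 : Fin N → V) :
    ℕ → Fin N → V
  | 0 => r0
  | t + 1 => fun i =>
      tracker A κ τ v r0 t i + v t i
        - κ • ∑ j, A i j •
            (tracker A κ τ v r0 t i - if τ t ≤ t then tracker A κ τ v r0 (t - τ t) j else 0)
  termination_by t => t
  decreasing_by all_goals omega

/-- The input increments `v` up to and including time `T`, and no input afterwards. -/
def inputUntil {N : ℕ} {V : Type*} [Zero V] (T : ℕ) (v : ℕ → Fin N → V) (t : ℕ) (i : Fin N) : V :=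
  if t ≤ T then v t i else 0

/-- The epoch whose stored values agent `i` reads for its update at time `(k + 1) * H`: values are
stored in epochs `[m * H, (m + 1) * H)` and keep their initial value at negative times, the value
that is read is the one stored at time `(k + 1) * H - τ((k + 1) * H)`, and values are read before
the update at time `(k + 1) * H` is written. -/
def readEpoch (H : ℕ) (τ : ℕ → ℕ) (k : ℕ) : ℕ :=
  min k (((k + 1) * H - τ ((k + 1) * H)) / H)

section Algorithm

variable {N n : ℕ} (A : Matrix (Fin N) (Fin N) ℝ) (u : Fin N → ℝ)
  (f : Fin N → EuclideanSpace ℝ (Fin n) → ℝ) (κ : ℝ) (H : ℕ) (τ : ℕ → ℕ)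
  (e : ℕ → Fin N → Fin N → ℝ) (x : ℕ → Fin N → EuclideanSpace ℝ (Fin n))

/-- The scaled gradient `∇f_i(x_i) / [e_i]_i` of agent `i` in epoch `k`. -/
def scaledGrad (k : ℕ) (i : Fin N) : EuclideanSpace ℝ (Fin n) :=
  (e k i i)⁻¹ • gradient (f i) (x k i)

/-- The impulse train that feeds the gradient tracker: at time `t = m * H` the change of the scaled
gradient between epochs `m - 1` and `m`. For `m = 0` the change is `0`, as all values are constant
up to time `0` (here `0 - 1 = 0`). -/
def gradImpulse (t : ℕ) (i : Fin N) : EuclideanSpace ℝ (Fin n) :=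
  if H ∣ t then scaledGrad f e x (t / H) i - scaledGrad f e x (t / H - 1) i else 0

/-- The increments of the square wave, which feed the delay tracker of every agent. -/
def waveIncrement (t : ℕ) (_ : Fin N) : ℝ :=
  squareWave H (t + 1) - squareWave H t

/-- The gradient tracker `r`, all of whose inputs after time `m * H` are switched off. Until time
`(m + 1) * H` it agrees with the tracker that receives the full impulse train. -/
def gradTracker (m t : ℕ) (i : Fin N) : EuclideanSpace ℝ (Fin n) :=
  tracker A κ τ (inputUntil (m * H) (gradImpulse f H e x)) (scaledGrad f e x 0) t i

/-- The delay tracker `s`, all of whose inputs after time `m * H` are switched off. Until time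
`(m + 1) * H` it agrees with the tracker that receives the full square wave. -/
def waveTracker (m t : ℕ) (i : Fin N) : ℝ :=
  tracker A κ τ (inputUntil (m * H) (waveIncrement H)) (fun _ => 1) t i

/-- The equilibrium state into which `r_i` settles after the impulse at time `m * H`. -/
def gradEquilibrium (m : ℕ) (i : Fin N) : EuclideanSpace ℝ (Fin n) :=
  limUnder atTop (fun t => gradTracker A f κ H τ e x m t i)

/-- The equilibrium state into which `s_i` settles after the edge at time `m * H`. -/
def waveEquilibrium (m : ℕ) (i : Fin N) : ℝ :=
  limUnder atTop (fun t => waveTracker A κ H τ m t i)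

/-- The descent direction `p_i` at time `k * H`: the changes of the equilibrium of `r_i` over the
epochs `1, …, k - 1`, each divided by the size of the change of the equilibrium of `s_i`, plus the
weighted average of the initial scaled gradients. -/
def direction (k : ℕ) (i : Fin N) : EuclideanSpace ℝ (Fin n) :=
  ∑ m ∈ Finset.Ico 1 k,
      |waveEquilibrium A κ H τ m i - waveEquilibrium A κ H τ (m - 1) i|⁻¹ •
        (gradEquilibrium A f κ H τ e x m i - gradEquilibrium A f κ H τ e x (m - 1) i)
    + ∑ j, u j • scaledGrad f e x 0 j

/-- `e` and `x` are produced by the delay-robust algorithm with step sizes `α`: `e k i` and `x k i`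
are the values of agent `i` in epoch `k`, that is, from time `k * H` on. The step from epoch `k` to
epoch `k + 1` has step size `α k`. -/
structure IsRun (α : ℕ → ℝ) : Prop where
  e_zero : ∀ i, e 0 i = Pi.single i 1
  e_succ : ∀ k i, e (k + 1) i = ∑ j, A i j • e (readEpoch H τ k) j
  x_succ : ∀ k i, x (k + 1) i =
    ∑ j, A i j • x (readEpoch H τ k) j - α k • direction A u f κ H τ e x (k + 1) i

end Algorithm

/-- The leading coefficient `A_k` of the contraction factor `A_k α² + B_k α + 4`. -/
def quadCoeff {N : ℕ} (u : Fin N → ℝ) (l : Fin N → NNReal) (e : ℕ → Fin N → Fin N → ℝ) (k : ℕ) :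
    ℝ :=
  4 * ∑ i, (N : ℝ) * (l i : ℝ) ^ 2 * (u i / e k i i) ^ 2

/-- The linear coefficient `B_k` of the contraction factor `A_k α² + B_k α + 4`. -/
def linCoeff {N : ℕ} (u : Fin N → ℝ) (l : Fin N → NNReal) (e : ℕ → Fin N → Fin N → ℝ) (k : ℕ) :
    ℝ :=
  ∑ i, -8 * (u i * (l i : ℝ) / e k i i)

/-- The step size `α_k = -B_k / (2 A_k)`, which minimises the contraction factor. -/
def stepSize {N : ℕ} (u : Fin N → ℝ) (l : Fin N → NNReal) (e : ℕ → Fin N → Fin N → ℝ) (k : ℕ) :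
    ℝ :=
  -linCoeff u l e k / (2 * quadCoeff u l e k)

end DelayFrost

end

/-! The trackers remove the unknown delay by calibration. Both are linear and suffer the same delay
`τ t`, which at each time is common to all agents. With inputs switched off, each step of a tracker
is a delayed convex combination, so strong connectivity forces consensus
(`IsDelayedAveraging.exists_consensus`). The average weighted by `u` obeys the same scalar delay
recursion for both trackers (`sum_smul_tracker`). Hence an edge moves the equilibrium of `s` by `±
ω` and that of `r` by `ω` times the weighted change of the scaled gradients, with one and the same
unknown `ω > 0` (`exists_equilibrium_succ_sub`). Division cancels `ω`, the sum telescopes, and the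
descent direction is exactly `∑ j, u j • scaledGrad f e x k j` (`direction_succ`).

Delays of at most one half period are invisible to the epoch updates (`readEpoch_eq`), so `e` and
`x` undergo delay-free averaging. Therefore `e k i i` tends to `u i`, the scaling undoes the bias of
the weights, and the step size converges to `(∑ l_i) / (N ∑ l_i²)`, which is at most `1 / ∑ l_i` by
Cauchy–Schwarz. All agents subtract the same correction, so their disagreement dies out. Their
weighted average performs gradient descent on `∑ i, f i` with vanishing errors, and the exact step
is a contraction by strong convexity (`norm_gradient_step_le`,
`tendsto_of_perturbed_gradient_descent`). -/

namespace DelayFrost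

/-! ### Consensus under delayed averaging -/

/-- The trajectory `y` follows the delayed averaging dynamics
`y_i(t+1) = c y_i(t) + ∑_j B_ij y_j(t - d(t))` from time `t₀` on. -/
def IsDelayedAveraging {N : ℕ} (c : ℝ) (B : Matrix (Fin N) (Fin N) ℝ) (d : ℕ → ℕ) (t₀ : ℕ)
    (y : ℕ → Fin N → ℝ) : Prop :=
  ∀ t, t₀ ≤ t → ∀ i, y (t + 1) i = c * y t i + ∑ j, B i j * y (t - d t) j

section Averaging

variable {N : ℕ} {c : ℝ} {B : Matrix (Fin N) (Fin N) ℝ} {d : ℕ → ℕ} {D t₀ : ℕ}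
  {y : ℕ → Fin N → ℝ} {M : ℝ}

theorem IsDelayedAveraging.neg (h : IsDelayedAveraging c B d t₀ y) :
    IsDelayedAveraging c B d t₀ (fun t i => -y t i) := by
  intro t ht i
  simp only [h t ht i, mul_neg, Finset.sum_neg_distrib]
  ring

/-- Each new value is a convex combination of values at most `D` steps old, so a bound on a window
of that length propagates forever. -/
theorem IsDelayedAveraging.le_of_le_window (h : IsDelayedAveraging c B d t₀ y)
    (hc : 0 ≤ c) (hB : ∀ i j, 0 ≤ B i j) (hsum : ∀ i, c + ∑ j, B i j = 1)
    (hd : ∀ t, d t ≤ D) {T : ℕ} (hT : t₀ ≤ T + D)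
    (hM : ∀ s, T ≤ s → s ≤ T + D → ∀ i, y s i ≤ M) (s : ℕ) (hs : T ≤ s) (i : Fin N) :
    y s i ≤ M := by
  induction s using Nat.strong_induction_on generalizing i with
  | _ s ih =>
    rcases le_or_gt s (T + D) with h1 | h1
    · exact hM s hs h1 i
    · obtain ⟨t, rfl⟩ : ∃ t, s = t + 1 := ⟨s - 1, by omega⟩
      have hdt := hd t
      rw [h t (by omega) i]
      have h2 : ∑ j, B i j * y (t - d t) j ≤ ∑ j, B i j * M :=
        Finset.sum_le_sum fun j _ =>
          mul_le_mul_of_nonneg_left (ih _ (by omega) (by omega) j) (hB i j)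
      have h3 : c * y t i ≤ c * M := mul_le_mul_of_nonneg_left (ih t (by omega) (by omega) i) hc
      rw [← Finset.sum_mul] at h2
      calc _ ≤ c * M + (∑ j, B i j) * M := add_le_add h3 h2
        _ = (c + ∑ j, B i j) * M := by ring
        _ = M := by rw [hsum, one_mul]

/-- The self-weight retains the fraction `c` of the gap in each step, since the other terms are at
most `M`. -/
theorem IsDelayedAveraging.gap_persists (h : IsDelayedAveraging c B d t₀ y)
    (hc : 0 ≤ c) (hB : ∀ i j, 0 ≤ B i j) (hsum : ∀ i, c + ∑ j, B i j = 1)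
    (hd : ∀ t, d t ≤ D) {s₀ : ℕ} (hs₀ : t₀ ≤ s₀)
    (hM : ∀ s, s₀ ≤ s + D → ∀ i, y s i ≤ M) {i : Fin N} {ε : ℝ} (hi : y s₀ i ≤ M - ε) (n : ℕ) :
    y (s₀ + n) i ≤ M - c ^ n * ε := by
  induction n with
  | zero => simpa using hi
  | succ n ih =>
    have hdt := hd (s₀ + n)
    rw [← add_assoc, h _ (by omega) i]
    have h2 : ∑ j, B i j * y (s₀ + n - d (s₀ + n)) j ≤ ∑ j, B i j * M :=
      Finset.sum_le_sum fun j _ =>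
        mul_le_mul_of_nonneg_left (hM _ (by omega) j) (hB i j)
    have h3 := mul_le_mul_of_nonneg_left ih hc
    rw [← Finset.sum_mul] at h2
    calc _ ≤ c * (M - c ^ n * ε) + (∑ j, B i j) * M := add_le_add h3 h2
      _ = (c + ∑ j, B i j) * M - c ^ (n + 1) * ε := by ring
      _ = _ := by rw [hsum, one_mul]

/-- A gap travels along edges. `δ` and `n` are chosen before the trajectory, so that the estimate
can be iterated. -/
theorem exists_gap_of_path (hc : 0 < c) (hB : ∀ i j, 0 ≤ B i j)
    (hsum : ∀ i, c + ∑ j, B i j = 1) (hd : ∀ t, d t ≤ D) {i₀ i : Fin N}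
    (hpath : Relation.ReflTransGen (fun a b => 0 < B b a) i₀ i) (t₀ : ℕ) :
    ∃ δ : ℝ, 0 < δ ∧ ∃ n : ℕ, ∀ (y : ℕ → Fin N → ℝ) (M ε : ℝ) (s₀ : ℕ),
      IsDelayedAveraging c B d t₀ y → t₀ ≤ s₀ → 0 ≤ ε →
      (∀ s, s₀ ≤ s + D → ∀ i, y s i ≤ M) → y s₀ i₀ ≤ M - ε →
        y (s₀ + n) i ≤ M - δ * ε := by
  induction hpath with
  | refl => exact ⟨1, one_pos, 0, fun y M ε s₀ _ _ _ _ h => by simpa using h⟩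
  | @tail i j _ hij ih =>
    obtain ⟨δ, hδ, n, ih⟩ := ih
    refine ⟨B j i * c ^ D * δ, by positivity, n + D + 1, ?_⟩
    intro y M ε s₀ hy hs₀ hε hM h0
    have h1 := ih y M ε s₀ hy hs₀ hε hM h0
    -- After waiting `D` steps, whatever time is read lies in `[s₀ + n, s₀ + n + D]`, where agent
    -- `i` still has a gap.
    set t := s₀ + n + D with ht
    have hdt := hd t
    have h2 : y (t - d t) i ≤ M - c ^ D * (δ * ε) := by
      obtain ⟨m, hm, hmD⟩ : ∃ m, t - d t = s₀ + n + m ∧ m ≤ D := ⟨D - d t, by omega, by omega⟩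
      rw [hm]
      refine (hy.gap_persists hc.le hB hsum hd (by omega) (fun s hs => hM s (by omega)) h1 m).trans ?_
      have hc1 : c ≤ 1 := by
        have := hsum i
        have := Finset.sum_nonneg fun j (_ : j ∈ Finset.univ) => hB i j
        linarith
      have := pow_le_pow_of_le_one hc.le hc1 hmD
      have := mul_le_mul_of_nonneg_right this (mul_nonneg hδ.le hε)
      linarith
    have h3 : ∑ k, B j k * y (t - d t) k ≤
        ∑ k, (B j k * M - if k = i then B j i * (c ^ D * (δ * ε)) else 0) := by
      refine Finset.sum_le_sum fun k _ => ?_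
      split_ifs with hk
      · subst hk
        rw [← mul_sub]
        exact mul_le_mul_of_nonneg_left h2 (hB _ _)
      · rw [sub_zero]
        exact mul_le_mul_of_nonneg_left (hM _ (by omega) k) (hB _ _)
    rw [Finset.sum_sub_distrib, ← Finset.sum_mul] at h3
    simp only [Finset.sum_ite_eq', Finset.mem_univ, if_true] at h3
    have h4 := mul_le_mul_of_nonneg_left (hM t (by omega) j) hc.le
    rw [show s₀ + (n + D + 1) = t + 1 by omega, hy t (by omega) j]
    calc _ ≤ c * M + ((∑ k, B j k) * M - B j i * (c ^ D * (δ * ε))) := add_le_add h4 h3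
      _ = (c + ∑ k, B j k) * M - B j i * c ^ D * δ * ε := by ring
      _ = _ := by rw [hsum, one_mul]

theorem exists_uniform_gap (hc : 0 < c) (hB : ∀ i j, 0 ≤ B i j)
    (hsum : ∀ i, c + ∑ j, B i j = 1) (hd : ∀ t, d t ≤ D)
    (hconn : IsStronglyConnected B) (hN : 0 < N) (t₀ : ℕ) :
    ∃ δ : ℝ, 0 < δ ∧ ∃ n : ℕ, ∀ (y : ℕ → Fin N → ℝ) (M ε : ℝ) (s₀ : ℕ) (i₀ : Fin N),
      IsDelayedAveraging c B d t₀ y → t₀ ≤ s₀ → 0 ≤ ε →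
      (∀ s, s₀ ≤ s + D → ∀ i, y s i ≤ M) → y s₀ i₀ ≤ M - ε →
        ∀ s, s₀ + n ≤ s → ∀ i, y s i ≤ M - δ * ε := by
  have hc1 : c ≤ 1 := by
    have := hsum ⟨0, hN⟩
    have := Finset.sum_nonneg fun j (_ : j ∈ Finset.univ) => hB ⟨0, hN⟩ j
    linarith
  have : Nonempty (Fin N) := ⟨⟨0, hN⟩⟩
  choose δ hδ n h using fun p : Fin N × Fin N =>
    exists_gap_of_path hc hB hsum hd (hconn p.1 p.2) t₀
  obtain ⟨p, hp⟩ := Finite.exists_min δ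
  obtain ⟨q, hq⟩ := Finite.exists_max n
  -- The gap must survive from its arrival until the end of a window starting at `s₀ + n q`, which
  -- takes at most `n q + D` steps.
  refine ⟨δ p * c ^ (n q + D), mul_pos (hδ p) (pow_pos hc _), n q, ?_⟩
  intro y M ε s₀ i₀ hy hs₀ hε hM h0 s hs i
  refine hy.le_of_le_window hc.le hB hsum hd (T := s₀ + n q) (by omega) ?_ s hs i
  intro s hs1 hs2 i
  have h1 := h (i₀, i) y M ε s₀ hy hs₀ hε hM h0
  obtain ⟨m, rfl, hm⟩ : ∃ m, s = s₀ + n (i₀, i) + m ∧ m ≤ n q + D :=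
    ⟨s - (s₀ + n (i₀, i)), by have := hq (i₀, i); omega, by omega⟩
  refine (hy.gap_persists hc.le hB hsum hd (by omega) (fun s hs => hM s (by omega)) h1 m).trans ?_
  have h2 := mul_le_mul (hp (i₀, i)) (pow_le_pow_of_le_one hc.le hc1 hm)
    (pow_nonneg hc.le _) (hδ _).le
  have := mul_le_mul_of_nonneg_right h2 hε
  linarith

/-- Any single value lies in the lower or the upper half of the range. This is a gap of half the
range from one end, and spreading it cuts the range by `δ / 2` of its length. -/
theorem exists_shrinking_range (hc : 0 < c) (hB : ∀ i j, 0 ≤ B i j)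
    (hsum : ∀ i, c + ∑ j, B i j = 1) (hd : ∀ t, d t ≤ D)
    (hconn : IsStronglyConnected B) (hN : 0 < N) (t₀ : ℕ) :
    ∃ ρ : ℝ, 0 ≤ ρ ∧ ρ < 1 ∧ ∀ y : ℕ → Fin N → ℝ, IsDelayedAveraging c B d t₀ y →
      ∀ (T : ℕ) (m M : ℝ), (∀ s, T ≤ s → ∀ i, m ≤ y s i ∧ y s i ≤ M) →
        ∃ (T' : ℕ) (m' M' : ℝ), (∀ s, T' ≤ s → ∀ i, m' ≤ y s i ∧ y s i ≤ M') ∧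
          M' - m' ≤ ρ * (M - m) := by
  obtain ⟨δ, hδ, n, h⟩ := exists_uniform_gap hc hB hsum hd hconn hN t₀
  -- The maximum is taken because no upper bound on `δ` is recorded.
  refine ⟨max 0 (1 - δ / 2), le_max_left _ _, max_lt one_pos (by linarith), ?_⟩
  intro y hy T m M hb
  have hmM : m ≤ M := (hb T le_rfl ⟨0, hN⟩).1.trans (hb T le_rfl ⟨0, hN⟩).2
  set s₀ := t₀ + T + D with hs₀
  have hρ : (1 - δ / 2) * (M - m) ≤ max 0 (1 - δ / 2) * (M - m) :=
    mul_le_mul_of_nonneg_right (le_max_right _ _) (by linarith)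
  rcases le_total (y s₀ ⟨0, hN⟩) ((m + M) / 2) with h0 | h0
  · have := h y M ((M - m) / 2) s₀ ⟨0, hN⟩ hy (by omega) (by linarith)
      (fun s hs i => (hb s (by omega) i).2) (by linarith)
    exact ⟨s₀ + n, m, M - δ * ((M - m) / 2),
      fun s hs i => ⟨(hb s (by omega) i).1, this s hs i⟩, by linarith⟩
  · have := h _ (-m) ((M - m) / 2) s₀ ⟨0, hN⟩ hy.neg (by omega) (by linarith)
      (fun s hs i => neg_le_neg (hb s (by omega) i).1) (by linarith)
    exact ⟨s₀ + n, m + δ * ((M - m) / 2), M,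
      fun s hs i => ⟨by linarith [this s hs i], (hb s (by omega) i).2⟩, by linarith⟩

/-- Delayed averaging over a strongly connected graph leads to consensus. -/
theorem IsDelayedAveraging.exists_consensus (h : IsDelayedAveraging c B d t₀ y)
    (hc : 0 < c) (hB : ∀ i j, 0 ≤ B i j) (hsum : ∀ i, c + ∑ j, B i j = 1)
    (hd : ∀ t, d t ≤ D) (hconn : IsStronglyConnected B) :
    ∃ a, ∀ i, Tendsto (fun t => y t i) atTop (𝓝 a) := by
  rcases Nat.eq_zero_or_pos N with rfl | hN
  · exact ⟨0, fun i => i.elim0⟩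
  obtain ⟨ρ, hρ0, hρ1, hshrink⟩ := exists_shrinking_range hc hB hsum hd hconn hN t₀
  obtain ⟨b, hb⟩ : ∃ b : ℝ, ∀ s, t₀ ≤ s → ∀ i, -b ≤ y s i ∧ y s i ≤ b := by
    have hle : ∀ s, s ≤ t₀ + D → ∀ i, |y s i| ≤ ∑ s ∈ Finset.range (t₀ + D + 1), ∑ i, |y s i| := by
      intro s hs i
      refine le_trans ?_ (Finset.single_le_sum (f := fun s => ∑ i, |y s i|)
        (fun s _ => Finset.sum_nonneg fun i _ => abs_nonneg _)
        (Finset.mem_range.2 (Nat.lt_succ_of_le hs)))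
      exact Finset.single_le_sum (f := fun i => |y s i|) (fun i _ => abs_nonneg _)
        (Finset.mem_univ i)
    refine ⟨∑ s ∈ Finset.range (t₀ + D + 1), ∑ i, |y s i|, fun s hs i => ⟨?_, ?_⟩⟩
    · exact neg_le.1 (h.neg.le_of_le_window hc.le hB hsum hd (T := t₀) (by omega)
        (fun s _ hs i => (neg_le_abs _).trans (hle s hs i)) s hs i)
    · exact h.le_of_le_window hc.le hB hsum hd (T := t₀) (by omega)
        (fun s _ hs i => (le_abs_self _).trans (hle s hs i)) s hs i
  have hrange : ∀ k : ℕ, ∃ (T : ℕ) (m M : ℝ), (∀ s, T ≤ s → ∀ i, m ≤ y s i ∧ y s i ≤ M) ∧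
      M - m ≤ ρ ^ k * (b - -b) := by
    intro k
    induction k with
    | zero => exact ⟨t₀, -b, b, hb, by simp⟩
    | succ k ih =>
      obtain ⟨T, m, M, h1, h2⟩ := ih
      obtain ⟨T', m', M', h3, h4⟩ := hshrink y h T m M h1
      refine ⟨T', m', M', h3, h4.trans ?_⟩
      rw [pow_succ', mul_assoc]
      exact mul_le_mul_of_nonneg_left h2 hρ0
  have hsmall : ∀ ε > 0, ∃ T, ∀ s, T ≤ s → ∀ i, ∀ s', T ≤ s' → ∀ i', |y s i - y s' i'| < ε := by
    intro ε hε
    have hlim : Tendsto (fun k : ℕ => ρ ^ k * (b - -b)) atTop (𝓝 0) := by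
      simpa using (tendsto_pow_atTop_nhds_zero_of_lt_one hρ0 hρ1).mul_const (b - -b)
    obtain ⟨k, hk⟩ := (hlim.eventually (gt_mem_nhds hε)).exists
    obtain ⟨T, m, M, h1, h2⟩ := hrange k
    refine ⟨T, fun s hs i s' hs' i' => ?_⟩
    have h3 := h1 s hs i
    have h4 := h1 s' hs' i'
    rw [abs_lt]
    constructor <;> linarith
  have hcauchy : CauchySeq fun t => y t ⟨0, hN⟩ := by
    refine Metric.cauchySeq_iff.2 fun ε hε => ?_
    obtain ⟨T, hT⟩ := hsmall ε hε
    exact ⟨T, fun s hs s' hs' => hT s hs _ s' hs' _⟩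
  obtain ⟨a, ha⟩ := cauchySeq_tendsto_of_complete hcauchy
  refine ⟨a, fun i => ?_⟩
  refine ha.congr_dist (Metric.tendsto_atTop.2 fun ε hε => ?_)
  obtain ⟨T, hT⟩ := hsmall ε hε
  refine ⟨T, fun s hs => ?_⟩
  rw [Real.dist_0_eq_abs, abs_dist]
  exact hT s hs _ s hs _

/-- Delayed averaging of vectors over a strongly connected graph leads to consensus. -/
theorem exists_consensus_of_delayed_averaging {n : ℕ} {y : ℕ → Fin N → EuclideanSpace ℝ (Fin n)}
    (h : ∀ t, t₀ ≤ t → ∀ i, y (t + 1) i = c • y t i + ∑ j, B i j • y (t - d t) j)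
    (hc : 0 < c) (hB : ∀ i j, 0 ≤ B i j) (hsum : ∀ i, c + ∑ j, B i j = 1)
    (hd : ∀ t, d t ≤ D) (hconn : IsStronglyConnected B) :
    ∃ a, ∀ i, Tendsto (fun t => y t i) atTop (𝓝 a) := by
  have hcoord : ∀ k, IsDelayedAveraging c B d t₀ (fun t i => y t i k) := by
    intro k t ht i
    simp [h t ht i]
  choose a ha using fun k => (hcoord k).exists_consensus hc hB hsum hd hconn
  refine ⟨WithLp.toLp 2 a, fun i => ?_⟩
  exact ((PiLp.continuous_toLp 2 _).tendsto a).comp (tendsto_pi_nhds.2 fun k => ha k i)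

end Averaging

/-! ### Stochastic weights and delay-free averaging -/

section Weights

variable {N : ℕ} {A : Matrix (Fin N) (Fin N) ℝ} {u : Fin N → ℝ}

/-- Self-loops are irrelevant for paths, so diagonal entries may be altered freely. -/
theorem IsStronglyConnected.of_offDiag {B : Matrix (Fin N) (Fin N) ℝ}
    (hA : IsStronglyConnected A) (h : ∀ i j, i ≠ j → 0 < A i j → 0 < B i j) :
    IsStronglyConnected B := by
  intro i j
  induction hA i j with
  | refl => exact .refl
  | @tail a b _ hab ih =>
    by_cases hne : b = a
    · exact hne ▸ ih
    · exact ih.tail (h _ _ hne hab)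

theorem IsFirstLeftEigenvector.sum_mul (hu : IsFirstLeftEigenvector A u) (j : Fin N) :
    ∑ i, u i * A i j = u j :=
  congrFun hu.1 j

theorem IsFirstLeftEigenvector.sum_smul_sum {V : Type*} [AddCommGroup V] [Module ℝ V]
    (hu : IsFirstLeftEigenvector A u) (z : Fin N → V) :
    ∑ i, u i • ∑ j, A i j • z j = ∑ j, u j • z j := by
  simp only [Finset.smul_sum, smul_smul]
  rw [Finset.sum_comm]
  simp only [← Finset.sum_smul, hu.sum_mul]

/-- Averaging with row-stochastic weights and positive self-weights over a strongly connected graph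
leads to consensus. -/
theorem exists_consensus_of_averaging {n : ℕ} {y : ℕ → Fin N → EuclideanSpace ℝ (Fin n)}
    (hA : IsRowStochastic A) (hconn : IsStronglyConnected A) (hdiag : ∀ i, 0 < A i i)
    (h : ∀ t i, y (t + 1) i = ∑ j, A i j • y t j) :
    ∃ a, ∀ i, Tendsto (fun t => y t i) atTop (𝓝 a) := by
  rcases Nat.eq_zero_or_pos N with rfl | hN
  · exact ⟨0, fun i => i.elim0⟩
  have : Nonempty (Fin N) := ⟨⟨0, hN⟩⟩
  obtain ⟨p, hp⟩ := Finite.exists_min fun i => A i i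
  -- Splitting off the smallest self-weight as a multiple of the identity leaves a non-negative
  -- matrix.
  refine exists_consensus_of_delayed_averaging (c := A p p) (B := A - Matrix.diagonal fun _ => A p p)
    (d := fun _ => 0) (D := 0) (t₀ := 0) ?_ (hdiag p) ?_ ?_ (fun _ => le_rfl) ?_
  · intro t _ i
    simp [h t i, Matrix.diagonal_apply, sub_smul, ite_smul]
  · intro i j
    rcases eq_or_ne i j with rfl | hij
    · simpa using hp i
    · simpa [hij] using hA.1 i j
  · intro i
    simp [Matrix.diagonal_apply, hA.2 i]
  · exact hconn.of_offDiag fun i j hij hpos => by simpa [hij] using hpos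

/-- The averaging limit is the average with the weights of the left eigenvector. -/
theorem tendsto_of_averaging {n : ℕ} {y : ℕ → Fin N → EuclideanSpace ℝ (Fin n)}
    (hA : IsRowStochastic A) (hconn : IsStronglyConnected A) (hdiag : ∀ i, 0 < A i i)
    (hu : IsFirstLeftEigenvector A u) (h : ∀ t i, y (t + 1) i = ∑ j, A i j • y t j) (i : Fin N) :
    Tendsto (fun t => y t i) atTop (𝓝 (∑ j, u j • y 0 j)) := by
  obtain ⟨a, ha⟩ := exists_consensus_of_averaging hA hconn hdiag h
  have hconst : ∀ t, ∑ j, u j • y t j = ∑ j, u j • y 0 j := by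
    intro t
    induction t with
    | zero => rfl
    | succ t ih => simp only [h t, hu.sum_smul_sum, ih]
  have hlim : Tendsto (fun t => ∑ j, u j • y t j) atTop (𝓝 (∑ j, u j • a)) :=
    tendsto_finsetSum _ fun j _ => (ha j).const_smul (u j)
  simp only [hconst, ← Finset.sum_smul, hu.2, one_smul] at hlim
  rw [tendsto_nhds_unique tendsto_const_nhds hlim]
  exact ha i

end Weights
-- Linearity, averages and limits of the trackers
section Tracker

variable {N : ℕ} {V : Type*} [AddCommGroup V] [Module ℝ V]
  {A : Matrix (Fin N) (Fin N) ℝ} {u : Fin N → ℝ} {κ : ℝ} {τ : ℕ → ℕ}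

theorem tracker_succ (v : ℕ → Fin N → V) (r0 : Fin N → V) (t : ℕ) (i : Fin N) :
    tracker A κ τ v r0 (t + 1) i = tracker A κ τ v r0 t i + v t i
        - κ • ∑ j, A i j •
            (tracker A κ τ v r0 t i - if τ t ≤ t then tracker A κ τ v r0 (t - τ t) j else 0) := by
  rw [tracker]

theorem tracker_succ_eq (hA : IsRowStochastic A) (v : ℕ → Fin N → V) (r0 : Fin N → V)
    (t : ℕ) (i : Fin N) :
    tracker A κ τ v r0 (t + 1) i = (1 - κ) • tracker A κ τ v r0 t i + v t i
        + κ • ∑ j, A i j • (if τ t ≤ t then tracker A κ τ v r0 (t - τ t) j else 0) := by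
  rw [tracker_succ]
  simp only [smul_sub, Finset.sum_sub_distrib, ← Finset.sum_smul, hA.2 i, sub_smul, one_smul]
  abel

theorem tracker_sub (v v' : ℕ → Fin N → V) (r0 r0' : Fin N → V) (t : ℕ) (i : Fin N) :
    tracker A κ τ v r0 t i - tracker A κ τ v' r0' t i = tracker A κ τ (v - v') (r0 - r0') t i := by
  induction t using Nat.strong_induction_on generalizing i with
  | _ t ih =>
    cases t with
    | zero => simp [tracker]
    | succ t =>
      rw [tracker_succ, tracker_succ, tracker_succ, ← ih t (by omega)]
      have hsum : ∀ j, (if τ t ≤ t then tracker A κ τ (v - v') (r0 - r0') (t - τ t) j else 0) =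
          (if τ t ≤ t then tracker A κ τ v r0 (t - τ t) j else 0) -
            if τ t ≤ t then tracker A κ τ v' r0' (t - τ t) j else 0 := by
        intro j
        split_ifs
        · exact (ih _ (by omega) j).symm
        · simp
      simp only [hsum, smul_sub, Finset.sum_sub_distrib, Pi.sub_apply]
      abel

/-- The weighted average of a tracker is a multiple of a scalar tracker, if the same holds for the
inputs and the scalar inputs are common to all agents. -/
theorem sum_smul_tracker (hA : IsRowStochastic A) (hu : IsFirstLeftEigenvector A u)
    {v : ℕ → Fin N → V} {r0 : Fin N → V} {v' : ℕ → Fin N → ℝ} {r0' : Fin N → ℝ} {U : V}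
    (h0 : ∀ i, ∑ j, u j • r0 j = r0' i • U) (hv : ∀ t i, ∑ j, u j • v t j = v' t i • U)
    (t : ℕ) (i : Fin N) :
    ∑ j, u j • tracker A κ τ v r0 t j = tracker A κ τ v' r0' t i • U := by
  induction t using Nat.strong_induction_on generalizing i with
  | _ t ih =>
    cases t with
    | zero => simpa [tracker] using h0 i
    | succ t =>
      -- Because all agents share one delay, the weighted sum is taken at a single past time and the
      -- induction hypothesis applies to it.
      have hpast : ∀ i, (∑ j, u j • if τ t ≤ t then tracker A κ τ v r0 (t - τ t) j else 0) =
          (if τ t ≤ t then tracker A κ τ v' r0' (t - τ t) i else 0) • U := by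
        intro i
        split_ifs
        · exact ih _ (by omega) i
        · simp
      simp only [tracker_succ_eq hA, smul_add, Finset.sum_add_distrib, hv t i, add_smul]
      simp only [smul_comm _ κ, smul_comm _ (1 - κ), ← Finset.smul_sum, ih t (by omega) i,
        hu.sum_smul_sum]
      simp only [smul_eq_mul, mul_smul, Finset.sum_smul, ← hpast]
      rw [← Finset.sum_smul, hA.2 i, one_smul]

theorem exists_tendsto_tracker {n : ℕ} {v : ℕ → Fin N → EuclideanSpace ℝ (Fin n)}
    {r0 : Fin N → EuclideanSpace ℝ (Fin n)} {T D : ℕ}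
    (hA : IsRowStochastic A) (hconn : IsStronglyConnected A) (hκ0 : 0 < κ) (hκ1 : κ < 1)
    (hτ : ∀ t, τ t ≤ D) (hv : ∀ t, T < t → ∀ i, v t i = 0) :
    ∃ a, ∀ i, Tendsto (fun t => tracker A κ τ v r0 t i) atTop (𝓝 a) := by
  -- From time `T + D + 1` on there is no input, and no read reaches the zero history before time
  -- `0`.
  refine exists_consensus_of_delayed_averaging (c := 1 - κ) (B := κ • A) (d := τ) (D := D)
    (t₀ := T + D + 1) ?_ (by linarith) ?_ ?_ hτ ?_
  · intro t ht i
    have := hτ t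
    have hpast : τ t ≤ t := by omega
    rw [tracker_succ_eq hA, hv t (by omega)]
    simp [Finset.smul_sum, smul_smul, hpast]
  · exact fun i j => mul_nonneg hκ0.le (hA.1 i j)
  · intro i
    simp [← Finset.mul_sum, hA.2 i]
  · exact hconn.of_offDiag fun i j _ h => mul_pos hκ0 h

theorem exists_tendsto_real_tracker {v : ℕ → Fin N → ℝ}
    {r0 : Fin N → ℝ} {T D : ℕ}
    (hA : IsRowStochastic A) (hconn : IsStronglyConnected A) (hκ0 : 0 < κ) (hκ1 : κ < 1)
    (hτ : ∀ t, τ t ≤ D) (hv : ∀ t, T < t → ∀ i, v t i = 0) :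
    ∃ a, ∀ i, Tendsto (fun t => tracker A κ τ v r0 t i) atTop (𝓝 a) := by
  have h : IsDelayedAveraging (1 - κ) (κ • A) τ (T + D + 1) (tracker A κ τ v r0) := by
    intro t ht i
    have := hτ t
    have hpast : τ t ≤ t := by omega
    rw [tracker_succ_eq hA, hv t (by omega)]
    simp [Finset.mul_sum, mul_assoc, hpast]
  refine h.exists_consensus (by linarith) (fun i j => mul_nonneg hκ0.le (hA.1 i j)) ?_ hτ
    (hconn.of_offDiag fun i j _ h => mul_pos hκ0 h)
  intro i
  simp [← Finset.mul_sum, hA.2 i]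

theorem tracker_impulse_nonneg (hA : IsRowStochastic A) (hκ0 : 0 < κ) (hκ1 : κ < 1)
    {v : ℕ → Fin N → ℝ} (hv : ∀ t i, 0 ≤ v t i) (t : ℕ) (i : Fin N) :
    0 ≤ tracker A κ τ v 0 t i := by
  induction t using Nat.strong_induction_on generalizing i with
  | _ t ih =>
    cases t with
    | zero => simp [tracker]
    | succ t =>
      rw [tracker_succ_eq hA]
      have h1 : ∀ j, 0 ≤ if τ t ≤ t then tracker A κ τ v 0 (t - τ t) j else 0 := by
        intro j
        split_ifs
        · exact ih _ (by omega) j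
        · exact le_rfl
      have h2 := Finset.sum_nonneg fun j (_ : j ∈ Finset.univ) => mul_nonneg (hA.1 i j) (h1 j)
      have h3 := mul_nonneg hκ0.le h2
      have h4 := mul_nonneg (sub_nonneg.2 hκ1.le) (ih t (by omega) i)
      simp only [smul_eq_mul]
      linarith [hv t i]

/-- The response to a unit impulse stays bounded below. -/
theorem le_tracker_impulse (hA : IsRowStochastic A) (hκ0 : 0 < κ) (hκ1 : κ < 1) {D T : ℕ}
    (hτ : ∀ t, τ t ≤ D) {v : ℕ → Fin N → ℝ} (hv : ∀ t i, 0 ≤ v t i) (hT : ∀ i, v T i = 1)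
    (s : ℕ) (i : Fin N) :
    (1 - κ) ^ min s D ≤ tracker A κ τ v 0 (T + 1 + s) i := by
  have hnonneg := tracker_impulse_nonneg (τ := τ) hA hκ0 hκ1 hv
  have hpast : ∀ t j, 0 ≤ if τ t ≤ t then tracker A κ τ v 0 (t - τ t) j else 0 := by
    intro t j
    split_ifs
    · exact hnonneg _ j
    · exact le_rfl
  have hpast' : ∀ t i, 0 ≤ ∑ j, A i j * if τ t ≤ t then tracker A κ τ v 0 (t - τ t) j else 0 :=
    fun t i => Finset.sum_nonneg fun j (_ : j ∈ Finset.univ) => mul_nonneg (hA.1 i j) (hpast t j)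
  induction s using Nat.strong_induction_on generalizing i with
  | _ s ih =>
    cases s with
    | zero =>
      have h3 := mul_nonneg hκ0.le (hpast' T i)
      have h4 := mul_nonneg (sub_nonneg.2 hκ1.le) (hnonneg T i)
      rw [add_zero, tracker_succ_eq hA, hT]
      simp only [smul_eq_mul, zero_le, min_eq_left, pow_zero]
      linarith
    | succ s =>
      set t := T + 1 + s with ht
      have hi := mul_le_mul_of_nonneg_left (ih s (by omega) i) (sub_nonneg.2 hκ1.le)
      rw [show T + 1 + (s + 1) = t + 1 by omega, tracker_succ_eq hA]
      simp only [smul_eq_mul]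
      -- For the first `D` steps only the agent's own decay by `1 - κ` is used. Afterwards every
      -- read falls at or after `T + 1`, so averaging preserves the floor `(1 - κ) ^ D`.
      rcases lt_or_ge s D with hs | hs
      · rw [min_eq_left (by omega)] at hi ⊢
        have h3 := mul_nonneg hκ0.le (hpast' t i)
        rw [pow_succ']
        linarith [hv t i]
      · rw [min_eq_right (by omega)] at hi ⊢
        have hle : ∑ j, A i j * (1 - κ) ^ D ≤
            ∑ j, A i j * if τ t ≤ t then tracker A κ τ v 0 (t - τ t) j else 0 := by
          refine Finset.sum_le_sum fun j _ => mul_le_mul_of_nonneg_left ?_ (hA.1 i j)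
          have hτt := hτ t
          obtain ⟨m, hm, hms⟩ : ∃ m, t - τ t = T + 1 + m ∧ m < s + 1 :=
            ⟨s - τ t, by omega, by omega⟩
          rw [if_pos (by omega), hm]
          exact (pow_le_pow_of_le_one (by linarith) (by linarith) (min_le_right _ _)).trans
            (ih m hms j)
        rw [← Finset.sum_mul, hA.2 i, one_mul] at hle
        have := mul_le_mul_of_nonneg_left hle hκ0.le
        linarith [hv t i]

theorem tracker_smul (a : ℝ) (v : ℕ → Fin N → ℝ) (r0 : Fin N → ℝ) (t : ℕ) (i : Fin N) :
    tracker A κ τ (a • v) (a • r0) t i = a * tracker A κ τ v r0 t i := by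
  induction t using Nat.strong_induction_on generalizing i with
  | _ t ih =>
    cases t with
    | zero => simp [tracker]
    | succ t =>
      rw [tracker_succ, tracker_succ, ih t (by omega)]
      have hsum : ∀ j, (if τ t ≤ t then tracker A κ τ (a • v) (a • r0) (t - τ t) j else 0) =
          a * if τ t ≤ t then tracker A κ τ v r0 (t - τ t) j else 0 := by
        intro j
        split_ifs
        · exact ih _ (by omega) j
        · simp
      simp only [hsum, ← mul_sub, smul_eq_mul, Pi.smul_apply, mul_left_comm _ a, ← Finset.mul_sum]
      ring

end Tracker

/-! ### Epochs and edges of the square wave -/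

/-- A delay of at most `H` reaches back no further than `k * H`, and reading precedes writing, so
the value of epoch `k` is read. -/
theorem readEpoch_eq {H : ℕ} {τ : ℕ → ℕ} (hH : 0 < H) (hτ : ∀ t, τ t ≤ H) (k : ℕ) :
    readEpoch H τ k = k := by
  refine min_eq_left ((Nat.le_div_iff_mul_le hH).2 ?_)
  have := hτ ((k + 1) * H)
  rw [add_mul, one_mul] at *
  omega

theorem waveIncrement_of_not_dvd {N H t : ℕ} (ht : ¬H ∣ t) (i : Fin N) :
    waveIncrement H t i = 0 := by
  obtain ⟨s, rfl⟩ : ∃ s, t = s + 1 :=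
    ⟨t - 1, by have : t ≠ 0 := (fun h => ht (h ▸ dvd_zero H)); omega⟩
  simp [waveIncrement, squareWave, Nat.succ_div, ht]

theorem waveIncrement_edge {N H : ℕ} (hH : 0 < H) (m : ℕ) (i : Fin N) :
    waveIncrement H ((m + 1) * H) i = (-1) ^ (m + 1) := by
  have h1 : (m + 1) * H / H = m + 1 := Nat.mul_div_cancel _ hH
  have h2 : ((m + 1) * H - 1) / H = m := by
    rw [Nat.div_eq_iff hH, add_mul, one_mul]
    omega
  have h3 : (m + 1) * H ≠ 0 := by positivity
  rcases Nat.even_or_odd m with hm | hm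
  · have hm' : ¬Even (m + 1) := by simpa [Nat.even_add_one] using hm
    simp [waveIncrement, squareWave, h1, h2, h3, hm, hm', pow_succ, hm.neg_one_pow]
  · have hm' : ¬Even m := by simpa using hm
    simp [waveIncrement, squareWave, h1, h2, h3, hm', pow_succ, hm.neg_one_pow]
    simp [Nat.even_add_one, hm']

theorem inputUntil_succ_sub {N H : ℕ} {V : Type*} [AddCommGroup V] {v : ℕ → Fin N → V}
    (hH : 0 < H) (hv : ∀ t i, ¬H ∣ t → v t i = 0) (m : ℕ) :
    inputUntil ((m + 1) * H) v - inputUntil (m * H) v =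
      fun t i => if t = (m + 1) * H then v ((m + 1) * H) i else 0 := by
  funext t i
  simp only [Pi.sub_apply, inputUntil]
  split_ifs with h1 h2 h3 h3 h3 h3
  · subst h3
    nlinarith
  · simp
  · rw [sub_zero, h3]
  · rw [sub_zero]
    refine hv t i ?_
    rintro ⟨q, rfl⟩
    rw [mul_comm H q] at h1 h2 h3
    have hq1 := Nat.le_of_mul_le_mul_right h1 hH
    have hq2 := lt_of_mul_lt_mul_right (not_le.1 h2) (Nat.zero_le H)
    exact h3 (by rw [show q = m + 1 by omega])
  · nlinarith
  · nlinarith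
  all_goals simp_all

/-! ### Equilibrium shifts and the descent direction -/

section Equilibrium

variable {N n : ℕ} {A : Matrix (Fin N) (Fin N) ℝ} {u : Fin N → ℝ}
  {f : Fin N → EuclideanSpace ℝ (Fin n) → ℝ} {κ : ℝ} {H D : ℕ} {τ : ℕ → ℕ}
  {e : ℕ → Fin N → Fin N → ℝ} {x : ℕ → Fin N → EuclideanSpace ℝ (Fin n)}

theorem exists_tendsto_gradTracker (hA : IsRowStochastic A) (hconn : IsStronglyConnected A)
    (hκ0 : 0 < κ) (hκ1 : κ < 1) (hτ : ∀ t, τ t ≤ D) (m : ℕ) :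
    ∃ c, ∀ i, Tendsto (fun t => gradTracker A f κ H τ e x m t i) atTop (𝓝 c) :=
  exists_tendsto_tracker hA hconn hκ0 hκ1 hτ (T := m * H) fun _ ht _ => if_neg (not_le.2 ht)

theorem exists_tendsto_waveTracker (hA : IsRowStochastic A) (hconn : IsStronglyConnected A)
    (hκ0 : 0 < κ) (hκ1 : κ < 1) (hτ : ∀ t, τ t ≤ D) (m : ℕ) :
    ∃ c, ∀ i, Tendsto (fun t => waveTracker A κ H τ m t i) atTop (𝓝 c) :=
  exists_tendsto_real_tracker hA hconn hκ0 hκ1 hτ (T := m * H) fun _ ht _ => if_neg (not_le.2 ht)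

theorem waveTracker_succ_sub (hH : 0 < H) (m t : ℕ) (i : Fin N) :
    waveTracker A κ H τ (m + 1) t i - waveTracker A κ H τ m t i =
      (-1) ^ (m + 1) * tracker A κ τ (fun t _ => if t = (m + 1) * H then (1 : ℝ) else 0) 0 t i := by
  rw [waveTracker, waveTracker, tracker_sub,
    inputUntil_succ_sub hH (fun t i h => waveIncrement_of_not_dvd h i), ← tracker_smul]
  congr 1
  · funext t i
    simp [waveIncrement_edge hH]
  · simp

theorem gradTracker_succ_sub (hH : 0 < H) (m t : ℕ) (i : Fin N) :
    gradTracker A f κ H τ e x (m + 1) t i - gradTracker A f κ H τ e x m t i =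
      tracker A κ τ (fun t i => if t = (m + 1) * H then
        scaledGrad f e x (m + 1) i - scaledGrad f e x m i else 0) 0 t i := by
  have hv : ∀ t i, ¬H ∣ t → gradImpulse f H e x t i = 0 := fun t i h => if_neg h
  rw [gradTracker, gradTracker, tracker_sub, inputUntil_succ_sub hH hv]
  simp [gradImpulse, Nat.mul_div_cancel _ hH]

/-- After each edge both equilibria move by the same multiple `ω > 0`: that of the gradient
tracker by `ω` times the change of the weighted average of its inputs, and that of the delay
tracker by `± ω`. -/
theorem exists_equilibrium_succ_sub (hA : IsRowStochastic A) (hconn : IsStronglyConnected A)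
    (hu : IsFirstLeftEigenvector A u) (hκ0 : 0 < κ) (hκ1 : κ < 1) (hH : 0 < H)
    (hτ : ∀ t, τ t ≤ D) (m : ℕ) (i : Fin N) :
    ∃ ω : ℝ, 0 < ω ∧
      waveEquilibrium A κ H τ (m + 1) i - waveEquilibrium A κ H τ m i = (-1) ^ (m + 1) * ω ∧
      gradEquilibrium A f κ H τ e x (m + 1) i - gradEquilibrium A f κ H τ e x m i =
        ω • ∑ j, u j • (scaledGrad f e x (m + 1) j - scaledGrad f e x m j) := by
  set w : ℕ → Fin N → ℝ := fun t _ => if t = (m + 1) * H then (1 : ℝ) else 0 with hw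
  -- `ω` is the consensus value of the response to a unit impulse at this edge; it depends on the
  -- delays.
  obtain ⟨ω, hω⟩ := exists_tendsto_real_tracker (v := w) (r0 := 0) (T := (m + 1) * H)
    hA hconn hκ0 hκ1 hτ fun t ht i => if_neg ht.ne'
  have hωpos : 0 < ω := by
    refine lt_of_lt_of_le (pow_pos (sub_pos.2 hκ1) D) (ge_of_tendsto (hω i) ?_)
    filter_upwards [eventually_ge_atTop ((m + 1) * H + 1)] with t ht
    obtain ⟨s, rfl⟩ := Nat.exists_eq_add_of_le ht
    refine le_trans ?_ (le_tracker_impulse hA hκ0 hκ1 hτ ?_ ?_ s i)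
    · exact pow_le_pow_of_le_one (by linarith) (by linarith) (min_le_right _ _)
    · intro t i
      simp only [hw]
      split_ifs <;> norm_num
    · simp [hw]
  refine ⟨ω, hωpos, ?_, ?_⟩
  · obtain ⟨a, ha⟩ := exists_tendsto_waveTracker (H := H) hA hconn hκ0 hκ1 hτ (m + 1)
    obtain ⟨b, hb⟩ := exists_tendsto_waveTracker (H := H) hA hconn hκ0 hκ1 hτ m
    rw [waveEquilibrium, waveEquilibrium, (ha i).limUnder_eq, (hb i).limUnder_eq]
    refine tendsto_nhds_unique ((ha i).sub (hb i)) ?_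
    simp only [waveTracker_succ_sub hH]
    exact (hω i).const_mul _
  · obtain ⟨a, ha⟩ := exists_tendsto_gradTracker (f := f) (H := H) (e := e) (x := x)
      hA hconn hκ0 hκ1 hτ (m + 1)
    obtain ⟨b, hb⟩ := exists_tendsto_gradTracker (f := f) (H := H) (e := e) (x := x)
      hA hconn hκ0 hκ1 hτ m
    rw [gradEquilibrium, gradEquilibrium, (ha i).limUnder_eq, (hb i).limUnder_eq]
    -- At consensus the limit equals its own weighted average, so only the averaged tracker has to
    -- be computed.
    have hlim := tendsto_finsetSum Finset.univ
      fun j (_ : j ∈ Finset.univ) => ((ha j).sub (hb j)).const_smul (u j)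
    rw [← Finset.sum_smul, hu.2, one_smul] at hlim
    refine tendsto_nhds_unique hlim ?_
    simp only [gradTracker_succ_sub hH]
    refine ((hω i).smul_const _).congr fun t => (sum_smul_tracker hA hu ?_ ?_ t i).symm
    · simp
    · intro t i
      simp only [hw]
      split_ifs <;> simp

/-- The descent direction is the weighted average of the scaled gradients. -/
theorem direction_succ (hA : IsRowStochastic A) (hconn : IsStronglyConnected A)
    (hu : IsFirstLeftEigenvector A u) (hκ0 : 0 < κ) (hκ1 : κ < 1) (hH : 0 < H)
    (hτ : ∀ t, τ t ≤ D) (k : ℕ) (i : Fin N) :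
    direction A u f κ H τ e x (k + 1) i = ∑ j, u j • scaledGrad f e x k j := by
  have hterm : ∀ m, |waveEquilibrium A κ H τ (1 + m) i - waveEquilibrium A κ H τ (1 + m - 1) i|⁻¹ •
      (gradEquilibrium A f κ H τ e x (1 + m) i - gradEquilibrium A f κ H τ e x (1 + m - 1) i) =
      ∑ j, u j • scaledGrad f e x (m + 1) j - ∑ j, u j • scaledGrad f e x m j := by
    intro m
    obtain ⟨ω, hω, hs, hr⟩ := exists_equilibrium_succ_sub (f := f) (e := e) (x := x)
      hA hconn hu hκ0 hκ1 hH hτ m i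
    rw [show 1 + m - 1 = m by omega, add_comm 1 m, hs, hr, abs_mul, abs_neg_one_pow, one_mul,
      abs_of_pos hω, smul_smul, inv_mul_cancel₀ hω.ne', one_smul]
    simp only [smul_sub, Finset.sum_sub_distrib]
  rw [direction, Finset.sum_Ico_eq_sum_range]
  simp only [hterm, Nat.add_sub_cancel]
  rw [Finset.sum_range_sub (fun m => ∑ j, u j • scaledGrad f e x m j), sub_add_cancel]

end Equilibrium

/-! ### Gradient descent with vanishing errors -/

section Optimization

variable {n : ℕ}

theorem hasDerivAt_comp_line {f : EuclideanSpace ℝ (Fin n) → ℝ}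
    (hf : Differentiable ℝ f) (x v : EuclideanSpace ℝ (Fin n)) (t : ℝ) :
    HasDerivAt (fun s : ℝ => f (x + s • v)) (inner ℝ (gradient f (x + t • v)) v) t := by
  have h1 : HasDerivAt (fun s : ℝ => x + s • v) v t := by
    simpa using ((hasDerivAt_id t).smul_const v).const_add x
  have h2 := (hf (x + t • v)).hasGradientAt.hasFDerivAt.comp_hasDerivAt t h1
  rwa [InnerProductSpace.toDual_apply_apply] at h2

/-- The quadratic upper bound for functions with Lipschitz gradient. -/
theorem IsSmoothWith.le_quadratic {f : EuclideanSpace ℝ (Fin n) → ℝ} {l : NNReal}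
    (hf : IsSmoothWith l f) (x v : EuclideanSpace ℝ (Fin n)) :
    f (x + v) ≤ f x + inner ℝ (gradient f x) v + l / 2 * ‖v‖ ^ 2 := by
  have hB : ∀ t : ℝ, HasDerivAt
      (fun t : ℝ => f x + t * inner ℝ (gradient f x) v + l / 2 * ‖v‖ ^ 2 * t ^ 2)
      (inner ℝ (gradient f x) v + l * t * ‖v‖ ^ 2) t := by
    intro t
    refine ((((hasDerivAt_id t).mul_const (inner ℝ (gradient f x) v)).const_add (f x)).fun_add
      ((hasDerivAt_pow 2 t).const_mul (l / 2 * ‖v‖ ^ 2))).congr_deriv ?_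
    push_cast
    ring
  have h := image_le_of_deriv_right_le_deriv_boundary (a := 0) (b := 1)
    (f := fun s : ℝ => f (x + s • v))
    (fun t _ => (hasDerivAt_comp_line hf.1 x v t).continuousAt.continuousWithinAt)
    (fun t _ => (hasDerivAt_comp_line hf.1 x v t).hasDerivWithinAt)
    (by simp) (fun t _ => (hB t).continuousAt.continuousWithinAt)
    (fun t _ => (hB t).hasDerivWithinAt)
    (fun t ht => by
      have h1 : inner ℝ (gradient f (x + t • v) - gradient f x) v ≤ l * t * ‖v‖ ^ 2 := by
        refine (real_inner_le_norm _ _).trans ?_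
        have h2 := hf.2.dist_le_mul (x + t • v) x
        rw [dist_eq_norm, dist_eq_norm, add_sub_cancel_left, norm_smul, Real.norm_of_nonneg ht.1]
          at h2
        calc _ ≤ l * (t * ‖v‖) * ‖v‖ := mul_le_mul_of_nonneg_right h2 (norm_nonneg _)
          _ = _ := by ring
      rw [inner_sub_left] at h1
      linarith)
    (Set.right_mem_Icc.2 zero_le_one)
  simpa using h

/-- The quadratic lower bound for strongly convex functions. -/
theorem quadratic_le_of_strongConvexOn {f : EuclideanSpace ℝ (Fin n) → ℝ} {σ : ℝ}
    (hf : Differentiable ℝ f)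
    (hσ : StrongConvexOn Set.univ σ f) (x v : EuclideanSpace ℝ (Fin n)) :
    f x + inner ℝ (gradient f x) v + σ / 2 * ‖v‖ ^ 2 ≤ f (x + v) := by
  have h1 := (hasDerivAt_comp_line hf x v 0).tendsto_slope_zero_right
  have h2 : Tendsto (fun t : ℝ => f (x + v) - f x - (1 - t) * (σ / 2 * ‖v‖ ^ 2)) (𝓝[>] 0)
      (𝓝 (f (x + v) - f x - (1 - 0) * (σ / 2 * ‖v‖ ^ 2))) :=
    ((continuous_const.sub ((continuous_const.sub continuous_id).mul continuous_const)).tendsto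
      0).mono_left nhdsWithin_le_nhds
  have h3 := le_of_tendsto_of_tendsto h1 h2 (by
    filter_upwards [Ioo_mem_nhdsGT (zero_lt_one' ℝ)] with t ht
    have h4 := hσ.2 (Set.mem_univ (x + v)) (Set.mem_univ x) ht.1.le (sub_nonneg.2 ht.2.le)
      (by ring)
    have h5 : t • (x + v) + (1 - t) • x = x + t • v := by module
    rw [h5, add_sub_cancel_left] at h4
    simp only [smul_eq_mul] at h4
    simp only [zero_add, zero_smul, add_zero, smul_eq_mul]
    rw [inv_mul_le_iff₀ ht.1]
    linarith)
  simp only [zero_smul, add_zero] at h3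
  linarith

variable {N : ℕ} {f : Fin N → EuclideanSpace ℝ (Fin n) → ℝ} {l : Fin N → NNReal}
  {σ : Fin N → ℝ} {xstar : EuclideanSpace ℝ (Fin n)}

/-- A gradient step of length at most `1 / ∑ l_i` is a contraction towards the minimiser. -/
theorem norm_gradient_step_le (hsmooth : ∀ i, IsSmoothWith (l i) (f i))
    (hstrong : ∀ i, StrongConvexOn Set.univ (σ i) (f i)) (hN : 0 < N)
    (hxstar : IsMinOn (objective f) Set.univ xstar) {α : ℝ} (hα0 : 0 < α)
    (hα : α * ∑ i, (l i : ℝ) ≤ 1) (x : EuclideanSpace ℝ (Fin n)) :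
    ‖x - α • ∑ i, gradient (f i) x - xstar‖ ^ 2 ≤
      (1 - α * ∑ i, σ i) * ‖x - xstar‖ ^ 2 := by
  set g := ∑ i, gradient (f i) x with hg
  have hlower : ∑ i, f i x + inner ℝ g (xstar - x) + (∑ i, σ i) / 2 * ‖xstar - x‖ ^ 2 ≤
      ∑ i, f i xstar := by
    have := Finset.sum_le_sum fun i (_ : i ∈ Finset.univ) =>
      quadratic_le_of_strongConvexOn (hsmooth i).1 (hstrong i) x (xstar - x)
    simpa only [Finset.sum_add_distrib, ← sum_inner, ← Finset.sum_mul, ← Finset.sum_div,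
      add_sub_cancel] using this
  have hupper : ∑ i, f i (x + -(α • g)) ≤
      ∑ i, f i x + inner ℝ g (-(α • g)) + (∑ i, (l i : ℝ)) / 2 * ‖-(α • g)‖ ^ 2 := by
    have := Finset.sum_le_sum fun i (_ : i ∈ Finset.univ) =>
      (hsmooth i).le_quadratic x (-(α • g))
    simpa only [Finset.sum_add_distrib, ← sum_inner, ← Finset.sum_mul, ← Finset.sum_div]
      using this
  have hmin : ∑ i, f i xstar ≤ ∑ i, f i (x + -(α • g)) := by
    have hpos : (0 : ℝ) < 1 / N := by positivity
    exact le_of_mul_le_mul_left (hxstar (Set.mem_univ (x + -(α • g)))) hpos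
  rw [inner_neg_right, inner_smul_right, real_inner_self_eq_norm_sq, norm_neg, norm_smul,
    Real.norm_of_nonneg hα0.le] at hupper
  have hexp : ‖x - α • g - xstar‖ ^ 2 =
      ‖x - xstar‖ ^ 2 + 2 * α * inner ℝ g (xstar - x) + α ^ 2 * ‖g‖ ^ 2 := by
    rw [show x - α • g - xstar = (x - xstar) - α • g by abel, norm_sub_sq_real, norm_smul,
      inner_smul_right, real_inner_comm, Real.norm_of_nonneg hα0.le, ← neg_sub x xstar,
      inner_neg_right]
    ring
  rw [norm_sub_rev xstar x] at hlower
  have h1 : α * (α * ∑ i, (l i : ℝ)) * ‖g‖ ^ 2 ≤ α * 1 * ‖g‖ ^ 2 := by gcongr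
  -- Descent lemma: the step lowers the sum by at least `α / 2 * ‖g‖ ^ 2`, and it cannot fall below
  -- the minimum.
  have h2 : α / 2 * ‖g‖ ^ 2 ≤ ∑ i, f i x - ∑ i, f i xstar := by nlinarith
  have h3 := mul_le_mul_of_nonneg_left h2 (by positivity : 0 ≤ 2 * α)
  have h4 := mul_le_mul_of_nonneg_left hlower (by positivity : 0 ≤ 2 * α)
  rw [hexp]
  nlinarith

/-- A perturbed contraction with vanishing perturbations converges to zero. -/
theorem tendsto_zero_of_perturbed_contraction {a δ η : ℕ → ℝ} {q : ℝ} (ha : ∀ k, 0 ≤ a k)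
    (hq0 : 0 ≤ q) (hq1 : q < 1) (hδ : Tendsto δ atTop (𝓝 0)) (hη : Tendsto η atTop (𝓝 0))
    (h : ∀ k, a (k + 1) ≤ (q + δ k) * a k + η k) : Tendsto a atTop (𝓝 0) := by
  -- The midpoint of `q` and `1` absorbs `δ`; once `η < (1 - p) * (ε / 2)`, the level `ε / 2` is the
  -- fixed point of the bounding affine recursion.
  set p := (1 + q) / 2 with hp
  have hp0 : 0 ≤ p := by linarith
  have hp1 : p < 1 := by linarith
  refine Metric.tendsto_atTop.2 fun ε hε => ?_
  have hev := (hδ.eventually (gt_mem_nhds (show 0 < (1 - q) / 2 by linarith))).and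
    (hη.eventually (gt_mem_nhds (show 0 < (1 - p) * (ε / 2) by nlinarith)))
  obtain ⟨K, hK⟩ := eventually_atTop.1 hev
  have hbound : ∀ m, a (K + m) ≤ ε / 2 + p ^ m * a K := by
    intro m
    induction m with
    | zero => simp; linarith
    | succ m ih =>
      obtain ⟨h1, h2⟩ := hK (K + m) (by omega)
      have h3 : (q + δ (K + m)) * a (K + m) ≤ p * a (K + m) :=
        mul_le_mul_of_nonneg_right (by linarith) (ha _)
      have h4 := mul_le_mul_of_nonneg_left ih hp0
      rw [← add_assoc, pow_succ']
      linarith [h (K + m)]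
  have hlim : Tendsto (fun m : ℕ => p ^ m * a K) atTop (𝓝 0) := by
    simpa using (tendsto_pow_atTop_nhds_zero_of_lt_one hp0 hp1).mul_const (a K)
  obtain ⟨M, hM⟩ := eventually_atTop.1 (hlim.eventually (gt_mem_nhds (half_pos hε)))
  refine ⟨K + M, fun k hk => ?_⟩
  obtain ⟨m, rfl⟩ := Nat.exists_eq_add_of_le (show K ≤ k by omega)
  rw [Real.dist_0_eq_abs, abs_of_nonneg (ha _)]
  linarith [hbound m, hM m (by omega)]

/-- Gradient descent with vanishing errors in the step sizes and in the points of evaluation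
converges to the minimiser. -/
theorem tendsto_of_perturbed_gradient_descent (hsmooth : ∀ i, IsSmoothWith (l i) (f i))
    (hσ : ∀ i, 0 < σ i) (hstrong : ∀ i, StrongConvexOn Set.univ (σ i) (f i)) (hN : 0 < N)
    (hxstar : IsMinOn (objective f) Set.univ xstar) {α : ℝ} (hα0 : 0 < α)
    (hα : α * ∑ i, (l i : ℝ) ≤ 1) {z : ℕ → EuclideanSpace ℝ (Fin n)} {β : ℕ → Fin N → ℝ}
    {y : ℕ → Fin N → EuclideanSpace ℝ (Fin n)}
    (hβ : ∀ j, Tendsto (fun k => β k j) atTop (𝓝 α))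
    (hy : ∀ j, Tendsto (fun k => y k j - z k) atTop (𝓝 0))
    (hz : ∀ k, z (k + 1) = z k - ∑ j, β k j • gradient (f j) (y k j)) :
    Tendsto z atTop (𝓝 xstar) := by
  have hμ : 0 < ∑ i, σ i := Finset.sum_pos (fun i _ => hσ i) ⟨⟨0, hN⟩, Finset.mem_univ _⟩
  have hβ' : ∀ j, Tendsto (fun k => |α - β k j|) atTop (𝓝 0) := fun j => by
    simpa using ((hβ j).const_sub α).abs
  rw [tendsto_iff_norm_sub_tendsto_zero]
  refine tendsto_zero_of_perturbed_contraction (q := Real.sqrt (1 - α * ∑ i, σ i))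
    (δ := fun k => ∑ j, |α - β k j| * l j)
    (η := fun k => ∑ j, (|α - β k j| * ‖gradient (f j) xstar‖ + |β k j| * (l j * ‖y k j - z k‖)))
    (fun k => norm_nonneg _) (Real.sqrt_nonneg _) ?_ ?_ ?_ ?_
  · rw [Real.sqrt_lt' one_pos]
    nlinarith
  · simpa using tendsto_finsetSum Finset.univ fun j (_ : j ∈ Finset.univ) =>
      (hβ' j).mul_const (l j : ℝ)
  · simpa using tendsto_finsetSum Finset.univ fun j (_ : j ∈ Finset.univ) =>
      ((hβ' j).mul_const ‖gradient (f j) xstar‖).add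
        ((hβ j).abs.mul ((hy j).norm.const_mul (l j : ℝ)))
  · intro k
    -- The individual gradients need not vanish at `xstar`. The step-size error is therefore split
    -- into a part proportional to the distance, which enters `δ`, and a constant part, which enters
    -- `η`.
    have hsplit : z (k + 1) - xstar = (z k - α • ∑ j, gradient (f j) (z k) - xstar) +
        ∑ j, ((α - β k j) • (gradient (f j) (z k) - gradient (f j) xstar) +
          (α - β k j) • gradient (f j) xstar -
          β k j • (gradient (f j) (y k j) - gradient (f j) (z k))) := by
      rw [hz, Finset.smul_sum]
      have : ∀ j, (α - β k j) • (gradient (f j) (z k) - gradient (f j) xstar) +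
          (α - β k j) • gradient (f j) xstar -
          β k j • (gradient (f j) (y k j) - gradient (f j) (z k)) =
          α • gradient (f j) (z k) - β k j • gradient (f j) (y k j) := fun j => by module
      simp only [this, Finset.sum_sub_distrib]
      abel
    have hmain : ‖z k - α • ∑ j, gradient (f j) (z k) - xstar‖ ≤
        Real.sqrt (1 - α * ∑ i, σ i) * ‖z k - xstar‖ := by
      have h := Real.le_sqrt_of_sq_le
        (norm_gradient_step_le hsmooth hstrong hN hxstar hα0 hα (z k))
      rwa [Real.sqrt_mul' _ (sq_nonneg _), Real.sqrt_sq (norm_nonneg _)] at h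
    have hterm : ∀ j, ‖(α - β k j) • (gradient (f j) (z k) - gradient (f j) xstar) +
          (α - β k j) • gradient (f j) xstar -
          β k j • (gradient (f j) (y k j) - gradient (f j) (z k))‖ ≤
        |α - β k j| * l j * ‖z k - xstar‖ +
          (|α - β k j| * ‖gradient (f j) xstar‖ + |β k j| * (l j * ‖y k j - z k‖)) := by
      intro j
      have h1 := (hsmooth j).2.dist_le_mul (z k) xstar
      have h2 := (hsmooth j).2.dist_le_mul (y k j) (z k)
      simp only [dist_eq_norm] at h1 h2
      refine (norm_sub_le _ _).trans ?_
      refine (add_le_add_left (norm_add_le _ _) _).trans ?_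
      simp only [norm_smul, Real.norm_eq_abs]
      have h3 := mul_le_mul_of_nonneg_left h1 (abs_nonneg (α - β k j))
      have h4 := mul_le_mul_of_nonneg_left h2 (abs_nonneg (β k j))
      linarith
    have hsum := (norm_sum_le _ _).trans (Finset.sum_le_sum fun j (_ : j ∈ Finset.univ) => hterm j)
    rw [Finset.sum_add_distrib, ← Finset.sum_mul] at hsum
    rw [hsplit, add_mul]
    refine (norm_add_le _ _).trans ?_
    linarith

end Optimization

/-! ### Convergence of a run -/

/-- Some entry is positive as the sum is `1`, and the eigenvector equation carries positivity
backwards along edges. -/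
theorem IsFirstLeftEigenvector.pos_of_nonneg {N : ℕ} {A : Matrix (Fin N) (Fin N) ℝ}
    {u : Fin N → ℝ} (hu : IsFirstLeftEigenvector A u) (hA : IsRowStochastic A)
    (hconn : IsStronglyConnected A) (h : ∀ i, 0 ≤ u i) (i : Fin N) : 0 < u i := by
  obtain ⟨i₀, -, hi₀⟩ : ∃ i₀ ∈ Finset.univ, 0 < u i₀ := by
    by_contra! hle
    have := Finset.sum_nonpos hle
    rw [hu.2] at this
    linarith
  induction hconn i i₀ using Relation.ReflTransGen.head_induction_on with
  | refl => exact hi₀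
  | @head a b hab _ ih =>
    rw [← hu.sum_mul a]
    exact (mul_pos ih hab).trans_le (Finset.single_le_sum (f := fun i => u i * A i a)
      (fun i _ => mul_nonneg (h i) (hA.1 i a)) (Finset.mem_univ b))

section Run

variable {N n : ℕ} {A : Matrix (Fin N) (Fin N) ℝ} {u : Fin N → ℝ}
  {f : Fin N → EuclideanSpace ℝ (Fin n) → ℝ} {κ : ℝ} {H D : ℕ} {τ : ℕ → ℕ}
  {e : ℕ → Fin N → Fin N → ℝ} {x : ℕ → Fin N → EuclideanSpace ℝ (Fin n)} {α : ℕ → ℝ}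

theorem IsRun.e_nonneg (hrun : IsRun A u f κ H τ e x α) (hA : IsRowStochastic A) (k : ℕ)
    (hread : ∀ k, readEpoch H τ k = k) (i j : Fin N) : 0 ≤ e k i j := by
  induction k generalizing i with
  | zero =>
    rw [hrun.e_zero]
    exact (Pi.single_nonneg.2 zero_le_one : (0 : Fin N → ℝ) ≤ Pi.single i 1) j
  | succ k ih =>
    simp only [hrun.e_succ, hread, Finset.sum_apply, Pi.smul_apply, smul_eq_mul]
    exact Finset.sum_nonneg fun m _ => mul_nonneg (hA.1 i m) (ih m)

theorem IsRun.e_diag_pos (hrun : IsRun A u f κ H τ e x α) (hA : IsRowStochastic A)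
    (hdiag : ∀ i, 0 < A i i) (hread : ∀ k, readEpoch H τ k = k) (k : ℕ) (i : Fin N) :
    0 < e k i i := by
  induction k with
  | zero => simp [hrun.e_zero]
  | succ k ih =>
    simp only [hrun.e_succ, hread, Finset.sum_apply, Pi.smul_apply, smul_eq_mul]
    exact (mul_pos (hdiag i) ih).trans_le (Finset.single_le_sum (f := fun m => A i m * e k m i)
      (fun m _ => mul_nonneg (hA.1 i m) (hrun.e_nonneg hA k hread m i)) (Finset.mem_univ i))

/-- The rows of `e` are averaged from the standard basis, whose average with weights `u` is `u`
itself. -/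
theorem IsRun.tendsto_e (hrun : IsRun A u f κ H τ e x α) (hA : IsRowStochastic A)
    (hconn : IsStronglyConnected A) (hdiag : ∀ i, 0 < A i i) (hu : IsFirstLeftEigenvector A u)
    (hread : ∀ k, readEpoch H τ k = k) (i j : Fin N) :
    Tendsto (fun k => e k i j) atTop (𝓝 (u j)) := by
  have h := tendsto_of_averaging (y := fun k i => WithLp.toLp 2 (e k i)) hA hconn hdiag hu
    (fun k i => by
      simp only [hrun.e_succ, hread]
      ext j
      simp) i
  have h2 := ((PiLp.continuous_ofLp 2 fun _ : Fin N => ℝ).tendsto _).comp h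
  have h3 := tendsto_pi_nhds.1 h2 j
  simpa [hrun.e_zero, Pi.single_apply] using h3

/-- Non-negativity comes from the run: the entries of `u` are limits of entries of `e`. -/
theorem IsRun.left_eigenvector_pos (hrun : IsRun A u f κ H τ e x α) (hA : IsRowStochastic A)
    (hconn : IsStronglyConnected A) (hdiag : ∀ i, 0 < A i i) (hu : IsFirstLeftEigenvector A u)
    (hread : ∀ k, readEpoch H τ k = k) (i : Fin N) : 0 < u i :=
  hu.pos_of_nonneg hA hconn (fun j => ge_of_tendsto' (hrun.tendsto_e hA hconn hdiag hu hread i j)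
    fun k => hrun.e_nonneg hA k hread i j) i

theorem tendsto_stepSize {l : Fin N → NNReal} (hu : ∀ i, 0 < u i)
    (he : ∀ i, Tendsto (fun k => e k i i) atTop (𝓝 (u i)))
    (hl : (N : ℝ) * ∑ i, (l i : ℝ) ^ 2 ≠ 0) :
    Tendsto (stepSize u l e) atTop (𝓝 ((∑ i, (l i : ℝ)) / (N * ∑ i, (l i : ℝ) ^ 2))) := by
  have hratio : ∀ i, Tendsto (fun k => u i / e k i i) atTop (𝓝 1) := fun i => by
    have h := (tendsto_const_nhds (x := u i)).div (he i) (hu i).ne'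
    rwa [div_self (hu i).ne'] at h
  have hB : Tendsto (linCoeff u l e) atTop (𝓝 (∑ i, -8 * (1 * (l i : ℝ)))) := by
    refine (tendsto_finsetSum Finset.univ fun i (_ : i ∈ Finset.univ) =>
      ((hratio i).mul_const (l i : ℝ)).const_mul (-8)).congr fun k => ?_
    simp only [linCoeff, div_mul_eq_mul_div]
  have hA : Tendsto (quadCoeff u l e) atTop (𝓝 (4 * ∑ i, (N : ℝ) * (l i : ℝ) ^ 2 * 1 ^ 2)) :=
    (tendsto_finsetSum Finset.univ fun i (_ : i ∈ Finset.univ) =>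
      ((hratio i).pow 2).const_mul ((N : ℝ) * (l i : ℝ) ^ 2)).const_mul 4
  simp only [one_mul, one_pow, mul_one, ← Finset.mul_sum] at hA hB
  have h := hB.neg.div (hA.const_mul 2) (by simpa using hl)
  have hval : -(-8 * ∑ i, (l i : ℝ)) / (2 * (4 * (N * ∑ i, (l i : ℝ) ^ 2))) =
      (∑ i, (l i : ℝ)) / (N * ∑ i, (l i : ℝ) ^ 2) := by
    rw [show -(-8 * ∑ i, (l i : ℝ)) = 8 * ∑ i, (l i : ℝ) by ring, ← mul_assoc]
    norm_num [mul_div_mul_left]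
  rwa [hval] at h

/-- All agents converge to the minimiser. -/
theorem IsRun.tendsto_minimiser {l : Fin N → NNReal} {σ : Fin N → ℝ}
    {xstar : EuclideanSpace ℝ (Fin n)}
    (hrun : IsRun A u f κ H τ e x (stepSize u l e)) (hA : IsRowStochastic A)
    (hconn : IsStronglyConnected A) (hdiag : ∀ i, 0 < A i i) (hu : IsFirstLeftEigenvector A u)
    (hsmooth : ∀ i, IsSmoothWith (l i) (f i))
    (hσ : ∀ i, 0 < σ i) (hstrong : ∀ i, StrongConvexOn Set.univ (σ i) (f i))
    (hl : 0 < (∑ i, (l i : ℝ)) ^ 2 / (N * ∑ i, (l i : ℝ) ^ 2))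
    (hxstar : IsMinOn (objective f) Set.univ xstar) (hread : ∀ k, readEpoch H τ k = k)
    (hdir : ∀ k i, direction A u f κ H τ e x (k + 1) i = ∑ j, u j • scaledGrad f e x k j)
    (i : Fin N) : Tendsto (fun k => x k i) atTop (𝓝 xstar) := by
  have hN : 0 < N := i.pos
  -- A zero numerator or denominator would make the quotient in `hl` zero.
  have hsum_ne : ∑ i, (l i : ℝ) ≠ 0 := fun h => by simp [h] at hl
  have hsum : 0 < ∑ i, (l i : ℝ) :=
    lt_of_le_of_ne (Finset.sum_nonneg fun i _ => (l i).2) hsum_ne.symm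
  have hsq_ne : (N : ℝ) * ∑ i, (l i : ℝ) ^ 2 ≠ 0 := fun h => by simp [h] at hl
  have hsq : 0 < (N : ℝ) * ∑ i, (l i : ℝ) ^ 2 := lt_of_le_of_ne (by positivity) hsq_ne.symm
  have hu_pos := hrun.left_eigenvector_pos hA hconn hdiag hu hread
  have he := fun i => hrun.tendsto_e hA hconn hdiag hu hread i i
  have hstep := tendsto_stepSize (l := l) hu_pos he hsq_ne
  set a := (∑ i, (l i : ℝ)) / (N * ∑ i, (l i : ℝ) ^ 2) with ha
  have ha0 : 0 < a := div_pos hsum hsq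
  have ha1 : a * ∑ i, (l i : ℝ) ≤ 1 := by
    rw [ha, div_mul_eq_mul_div, div_le_one hsq, ← sq]
    simpa using sq_sum_le_card_mul_sum_sq (s := Finset.univ) (f := fun i => (l i : ℝ))
  set z : ℕ → EuclideanSpace ℝ (Fin n) := fun k => ∑ j, u j • x k j with hz
  have hx : ∀ k i, x (k + 1) i =
      ∑ j, A i j • x k j - stepSize u l e k • ∑ j, u j • scaledGrad f e x k j := by
    intro k i
    rw [hrun.x_succ, hread, hdir]
  have hz_succ : ∀ k, z (k + 1) = z k - stepSize u l e k • ∑ j, u j • scaledGrad f e x k j := by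
    intro k
    simp only [hz, hx, smul_sub, Finset.sum_sub_distrib, hu.sum_smul_sum, ← Finset.sum_smul, hu.2,
      one_smul]
  have hcons : ∀ j, Tendsto (fun k => x k j - z k) atTop (𝓝 0) := by
    intro j
    -- The common correction cancels in `x k i - z k`, which thus follows pure averaging; its
    -- weighted average is zero.
    have h := tendsto_of_averaging (y := fun k i => x k i - z k) hA hconn hdiag hu
      (fun k i => by
        simp only [hx, hz_succ, smul_sub, Finset.sum_sub_distrib, ← Finset.sum_smul, hA.2,
          one_smul]
        abel) j
    simpa only [smul_sub, Finset.sum_sub_distrib, ← Finset.sum_smul, hu.2, one_smul, hz, sub_self]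
      using h
  have hlim : Tendsto z atTop (𝓝 xstar) := by
    refine tendsto_of_perturbed_gradient_descent hsmooth hσ hstrong hN hxstar ha0 ha1
      (β := fun k j => stepSize u l e k * (u j * (e k j j)⁻¹)) (y := x) (fun j => ?_) hcons
      fun k => ?_
    · have h := hstep.mul (((he j).inv₀ (hu_pos j).ne').const_mul (u j))
      rwa [mul_inv_cancel₀ (hu_pos j).ne', mul_one] at h
    · rw [hz_succ, Finset.smul_sum]
      simp only [scaledGrad, smul_smul]
  simpa using (hcons i).add hlim

end Run

end DelayFrost

theorem theorem2 {N n : ℕ} (A : Matrix (Fin N) (Fin N) ℝ) (u : Fin N → ℝ)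
    (hA : DelayFrost.IsRowStochastic A) (hconn : DelayFrost.IsStronglyConnected A)
    (hdiag : ∀ i, 0 < A i i) (hu : DelayFrost.IsFirstLeftEigenvector A u)
    (f : Fin N → EuclideanSpace ℝ (Fin n) → ℝ) (l : Fin N → NNReal) (σ : Fin N → ℝ)
    (hsmooth : ∀ i, DelayFrost.IsSmoothWith (l i) (f i))
    (hσ : ∀ i, 0 < σ i) (hstrong : ∀ i, StrongConvexOn Set.univ (σ i) (f i))
    (hl : 3 / 4 < (∑ i, (l i : ℝ)) ^ 2 / (N * ∑ i, (l i : ℝ) ^ 2))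
    (xstar : EuclideanSpace ℝ (Fin n))
    (hxstar : IsMinOn (DelayFrost.objective f) Set.univ xstar)
    (κ : ℝ) (hκ0 : 0 < κ) (hκ1 : κ < 1)
    (H τmax : ℕ) (τ : ℕ → ℕ) (hH : 0 < H) (hτ : ∀ t, τ t ≤ τmax) (hτH : τmax ≤ H)
    (e : ℕ → Fin N → Fin N → ℝ) (x : ℕ → Fin N → EuclideanSpace ℝ (Fin n))
    (hrun : DelayFrost.IsRun A u f κ H τ e x (DelayFrost.stepSize u l e)) :
    -- every quantity that the algorithm uses is well defined
    ((∀ k i, 0 < e k i i) ∧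
      (∀ m i, ∃ c, Filter.Tendsto (fun t => DelayFrost.gradTracker A f κ H τ e x m t i)
        Filter.atTop (nhds c)) ∧
      (∀ m i, ∃ c, Filter.Tendsto (fun t => DelayFrost.waveTracker A κ H τ m t i)
        Filter.atTop (nhds c)) ∧
      (∀ m i, DelayFrost.waveEquilibrium A κ H τ (m + 1) i ≠
        DelayFrost.waveEquilibrium A κ H τ m i)) ∧
    -- every agent is eventually within a constant times `ε` of the optimum
    ∃ C : ℝ, 0 < C ∧ ∀ ε : ℝ, 0 < ε → ∀ i, ∃ k₃ : ℕ, ∀ k ≥ k₃, ‖x k i - xstar‖ < C * ε := by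

  have hread := DelayFrost.readEpoch_eq hH fun t => (hτ t).trans hτH
  refine ⟨⟨hrun.e_diag_pos hA hdiag hread, fun m i => ?_, fun m i => ?_, fun m i => ?_⟩, 1,
    one_pos, fun ε hε i => ?_⟩
  · obtain ⟨c, hc⟩ := DelayFrost.exists_tendsto_gradTracker hA hconn hκ0 hκ1 hτ m
    exact ⟨c, hc i⟩
  · obtain ⟨c, hc⟩ := DelayFrost.exists_tendsto_waveTracker hA hconn hκ0 hκ1 hτ m
    exact ⟨c, hc i⟩
  · obtain ⟨ω, hω, h, -⟩ := DelayFrost.exists_equilibrium_succ_sub (f := f) (e := e) (x := x)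
      hA hconn hu hκ0 hκ1 hH hτ m i
    rw [← sub_ne_zero, h]
    exact mul_ne_zero (pow_ne_zero _ (by norm_num)) hω.ne'
  · have hlim := hrun.tendsto_minimiser hA hconn hdiag hu hsmooth hσ hstrong (by linarith) hxstar
      hread (DelayFrost.direction_succ hA hconn hu hκ0 hκ1 hH hτ) i
    obtain ⟨K, hK⟩ := Metric.tendsto_atTop.1 hlim ε hε
    exact ⟨K, fun k hk => by simpa [dist_eq_norm] using hK k hk⟩
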